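/- Let $k$ be an algebraically closed field. A \emph{curve} is a nonempty, locally Cohen--Macaulay, purely one-dimensional closed subscheme $C$ of $\mathbb{P}^3=\mathbb{P}^3_k$, with ideal sheaf $\mathcal{I}_C$; its degree $\deg(C)$ and arithmetic genus $g(C)$ are defined by its Hilbert polynomial $\chi(\mathcal{O}_C(n))=n\deg(C)+1-g(C)$. Put $$B(d,s)=\begin{cases}(s-1)d+1-\binom{s+2}{3}, & s\le d\le 2s,\\[2pt] \binom{d-s}{2}-\binom{s-1}{3}, & d\ge 2s+1,\end{cases}\qquad\text{so that } B(d,d)=-(d-1)-\binom{d}{3}.$$ For integers $e\ge 1$ and $\ell\ge 0$, a curve $C$ of degree $e$ whose support is a line $L$ is called a $C_{e,\ell}$ if its genus is $B(e,e)-\ell\binom{e}{2}$ and $$H^0\big(\mathcal{I}_C(\ell+e-1)\big)=H^0\big(\mathcal{I}_L^{\,e}(\ell+e-1)\big)$$ as spaces of forms of degree $\ell+e-1$, where $\mathcal{I}_L$ is the ideal sheaf of the reduced line $L$. \textbf{Proposition.} Let $d$ and $m$ be integers with $1\le m\le d-1$. Let $C$ be a $C_{m,d-m}$ and let $D$ be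 a $C_{d-m,m}$, and suppose that their supporting lines are disjoint. Then the disjoint union $C\cup D$ is a curve of degree $d$ and genus $B(d,d)$, and it does not lie on a surface of degree $d-1$, that is, no nonzero form of degree $d-1$ vanishes on $C\cup D$. -/

import Mathlib

noncomputable section

namespace SpaceCurve

open AlgebraicGeometry TopologicalSpace

universe u

/-- The standard grading of the polynomial ring `k[x₀, x₁, x₂, x₃]`: the `n`-th piece is the space
of forms of degree `n`. -/
abbrev grading (k : Type u) [Field k] : ℕ → Submodule k (MvPolynomial (Fin 4) k) :=
  MvPolynomial.homogeneousSubmodule (Fin 4) k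

/-- Projective 3-space over `k`. -/
instance instGradedAlgebra (k : Type u) [Field k] : GradedAlgebra (grading k) :=
  MvPolynomial.gradedAlgebra

abbrev P3 (k : Type u) [Field k] : Scheme.{u} := Proj (grading k)

variable {k : Type u} [Field k]

theorem X_mem_grading (i : Fin 4) : (MvPolynomial.X i : MvPolynomial (Fin 4) k) ∈ grading k 1 :=
  MvPolynomial.isHomogeneous_X k i

variable (k) in
/-- The standard affine chart `D₊(xᵢ)` of projective 3-space. -/
def chart (i : Fin 4) : (P3 k).affineOpens :=
  ⟨Proj.basicOpen (grading k) (MvPolynomial.X i),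
    Proj.isAffineOpen_basicOpen (grading k) _ (X_mem_grading i) one_pos⟩

/-- The fraction `F / xᵢⁿ`, of degree zero, attached to a form `F` of degree `n`. -/
def fraction (i : Fin 4) {n : ℕ} (F : grading k n) :
    HomogeneousLocalization.Away (grading k) (MvPolynomial.X i : MvPolynomial (Fin 4) k) :=
  HomogeneousLocalization.Away.mk (grading k) (X_mem_grading i) n F.1 (by simp)

/-- The regular function `F / xᵢⁿ` on the chart `D₊(xᵢ)`, for a form `F` of degree `n`. -/
def dehomogenize (i : Fin 4) {n : ℕ} (F : grading k n) : Γ(P3 k, (chart k i).1) :=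
  (Proj.awayToSection (grading k) (MvPolynomial.X i)).hom (fraction i F)

theorem fraction_zero (i : Fin 4) {n : ℕ} : fraction i (0 : grading k n) = 0 := by
  apply HomogeneousLocalization.val_injective
  simp [fraction, HomogeneousLocalization.Away.val_mk, Localization.mk_zero]

theorem fraction_add (i : Fin 4) {n : ℕ} (F G : grading k n) :
    fraction i (F + G) = fraction i F + fraction i G := by
  apply HomogeneousLocalization.val_injective
  simp [fraction, HomogeneousLocalization.Away.val_mk, ← Localization.add_mk_self]

theorem fraction_smul (i : Fin 4) {n : ℕ} (c : k) (F : grading k n) :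
    fraction i (c • F) =
      fraction i (⟨MvPolynomial.C c, MvPolynomial.isHomogeneous_C _ c⟩ : grading k 0) *
        fraction i F := by
  apply HomogeneousLocalization.val_injective
  simp [fraction, HomogeneousLocalization.Away.val_mk, Localization.mk_mul,
    MvPolynomial.smul_eq_C_mul]

theorem dehomogenize_zero (i : Fin 4) {n : ℕ} : dehomogenize i (0 : grading k n) = 0 :=
  (congrArg _ (fraction_zero i)).trans (map_zero _)

theorem dehomogenize_add (i : Fin 4) {n : ℕ} (F G : grading k n) :
    dehomogenize i (F + G) = dehomogenize i F + dehomogenize i G :=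
  (congrArg _ (fraction_add i F G)).trans (map_add _ _ _)

theorem dehomogenize_smul (i : Fin 4) {n : ℕ} (c : k) (F : grading k n) :
    dehomogenize i (c • F) =
      dehomogenize i (⟨MvPolynomial.C c, MvPolynomial.isHomogeneous_C _ c⟩ : grading k 0) *
        dehomogenize i F :=
  (congrArg _ (fraction_smul i c F)).trans (map_mul _ _ _)

/-- For a closed subscheme of `ℙ³` with ideal sheaf `I`, the space `H⁰(ℙ³, I(n))`: the forms of
degree `n` that vanish on the subscheme, i.e. whose dehomogenization in each standard chart is a
section of `I`. -/
def sectionsTwist (I : (P3 k).IdealSheafData) (n : ℕ) : Submodule k (grading k n) where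
  carrier := {F | ∀ i : Fin 4, dehomogenize i F ∈ I.ideal (chart k i)}
  zero_mem' i := by
    rw [dehomogenize_zero]
    exact (I.ideal (chart k i)).zero_mem
  add_mem' {F G} hF hG i := by
    rw [dehomogenize_add]
    exact (I.ideal (chart k i)).add_mem (hF i) (hG i)
  smul_mem' c F hF i := by
    rw [dehomogenize_smul]
    exact (I.ideal (chart k i)).mul_mem_left _ (hF i)

/-- A local ring is Cohen-Macaulay if its maximal ideal contains a regular sequence whose length
is the Krull dimension of the ring. (Used only for Noetherian local rings.) -/
def IsCohenMacaulayLocal (R : Type u) [CommRing R] [IsLocalRing R] : Prop :=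
  ∃ rs : List R, (∀ r ∈ rs, r ∈ IsLocalRing.maximalIdeal R) ∧
    RingTheory.Sequence.IsRegular R rs ∧ (rs.length : WithBot ℕ∞) = ringKrullDim R

/-- A space curve: a nonempty closed subscheme of `ℙ³` (given by its ideal sheaf) that is locally
Cohen-Macaulay and purely one-dimensional, i.e. all its irreducible components have dimension
one. -/
structure IsCurve (C : (P3 k).IdealSheafData) : Prop where
  nonempty : (C.support : Set (P3 k)).Nonempty
  locallyCohenMacaulay : ∀ x : C.subscheme, IsCohenMacaulayLocal (C.subscheme.presheaf.stalk x)
  pureDimOne : ∀ Z : Set (P3 k),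
    Maximal (fun W : Set (P3 k) => IsIrreducible W ∧ W ⊆ (C.support : Set (P3 k))) Z →
      topologicalKrullDim Z = 1

/-- The Hilbert function of the closed subscheme `C` of `ℙ³`: the dimension of the degree `n` part
of its homogeneous coordinate ring. -/
def hilbertFunction (C : (P3 k).IdealSheafData) (n : ℕ) : ℕ :=
  Module.finrank k (grading k n ⧸ sectionsTwist C n)

/-- `C` has degree `d` and arithmetic genus `g`: its Hilbert polynomial (the polynomial that agrees
with the Hilbert function in all large degrees) is `n * d + 1 - g`. -/
def HasDegreeGenus (C : (P3 k).IdealSheafData) (d : ℕ) (g : ℤ) : Prop :=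
  ∀ᶠ n : ℕ in Filter.atTop, (hilbertFunction C n : ℤ) = n * d + 1 - g

/-- A line in `ℙ³`: the zero locus of two linearly independent linear forms. -/
def IsLine (L : Closeds (P3 k)) : Prop :=
  ∃ a b : grading k 1, LinearIndependent k ![a, b] ∧
    (L : Set (P3 k)) = ProjectiveSpectrum.zeroLocus (grading k) {a.1, b.1}

/-- The subscheme `C` lies on a surface of degree `n`. -/
def LiesOnSurface (C : (P3 k).IdealSheafData) (n : ℕ) : Prop :=
  ∃ F : grading k n, F ≠ 0 ∧ F ∈ sectionsTwist C n

/-- Beorchia's bound `B(d, s)` for `1 ≤ s ≤ d`. -/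
def beorchiaBound (d s : ℕ) : ℤ :=
  if d ≤ 2 * s then ((s : ℤ) - 1) * d + 1 - ((s + 2).choose 3 : ℤ)
  else ((d - s).choose 2 : ℤ) - ((s - 1).choose 3 : ℤ)

/-- `C` is a `C_{d,ℓ}` with supporting line `L`: a curve of degree `d ≥ 1` supported on the line
`L`, of genus `B(d,d) - ℓ * (d choose 2)`, such that
`H⁰(I_C(ℓ + d - 1)) = H⁰(I_L ^ d (ℓ + d - 1))`. Here `I_L` is the ideal sheaf of the reduced
line. -/
structure IsCdlOn (C : (P3 k).IdealSheafData) (L : Closeds (P3 k)) (d l : ℕ) : Prop where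
  one_le : 1 ≤ d
  isLine : IsLine L
  isCurve : IsCurve C
  support_eq : C.support = L
  degree_genus : HasDegreeGenus C d (beorchiaBound d d - (l : ℤ) * (d.choose 2 : ℤ))
  sections_eq : sectionsTwist C (l + d - 1) =
    sectionsTwist (Scheme.IdealSheafData.vanishingIdeal L ^ d) (l + d - 1)

end SpaceCurve

end

/-! Let `L = {a = b = 0}` and `M = {c = d = 0}` be the two lines and `p + q` the degree, with `C`
a `C_{p,q}` on `L` and `D` a `C_{q,p}` on `M`.

*Curve.* The ideal sheaf of `C ∪ D` is `I_C ⊓ I_D`. Near each point one of the two ideals is the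
unit ideal, so `C ∪ D` is locally isomorphic to `C` or to `D`, and it inherits the Cohen-Macaulay
property (`isCohenMacaulayLocal_stalk_inf`). Its irreducible components are those of `L` and `M`.

*Genus.* Since `L` and `M` are disjoint, `a, b, c, d` is a basis of the linear forms
(`isCompl_span_of_disjoint_zeroLocus`). Powers of `a` and `b` vanish on `C`, powers of `c` and `d`
vanish on `D`, and hence every form of large degree is a sum of a form vanishing on `C` and one
vanishing on `D` (`eventually_sectionsTwist_sup_eq_top`). So the Hilbert function of `C ∪ D` is
eventually the sum of those of `C` and `D`, and the genus comes out by the Vandermonde identity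
(`beorchiaBound_add`).

*Surfaces.* By hypothesis a form of degree `p + q - 1` vanishing on `C ∪ D` lies in `H⁰(I_L ^ p)`
and in `H⁰(I_M ^ q)`. In the coordinates `a, b, c, d` each of its monomials has degree at least
`p` in `a, b` and at least `q` in `c, d`, so there are none. To avoid a change of coordinates, the
orders are measured by the substitution `u ↦ g u + t h u` on linear forms (`pencil`), where `g`
and `h` are the projections of the decomposition `⟨c, d⟩ ⊕ ⟨a, b⟩`: a form in `H⁰(I_L ^ p)`
becomes divisible by `t ^ p` (`X_pow_dvd_pencil_of_mem_sectionsTwist`), and exchanging `g` and `h`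
reverses the coefficients in `t` (`natDegree_pencil_le_and_reflect`). -/

noncomputable section

namespace SpaceCurve

open AlgebraicGeometry TopologicalSpace

universe u

variable {k : Type u} [Field k]

/-! ### Cohen-Macaulay stalks of closed subschemes -/

theorem IsCohenMacaulayLocal.of_ringEquiv {R S : Type u} [CommRing R] [CommRing S] [IsLocalRing R]
    [IsLocalRing S] (e : R ≃+* S) (h : IsCohenMacaulayLocal R) : IsCohenMacaulayLocal S := by
  obtain ⟨rs, hmem, hreg, hdim⟩ := h
  refine ⟨rs.map e, ?_, ?_, ?_⟩
  · intro s hs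
    obtain ⟨r, hr, rfl⟩ := List.mem_map.mp hs
    have := hmem r hr
    rw [IsLocalRing.mem_maximalIdeal, mem_nonunits_iff] at this ⊢
    rwa [MulEquiv.isUnit_map]
  · refine (AddEquiv.isRegular_congr (e := e.toAddEquiv) (as := rs) ?_).mp hreg
    rw [List.forall₂_map_right_iff, List.forall₂_same]
    intro r _ x
    simp
  · rw [List.length_map, hdim]
    exact ringKrullDim_eq_of_ringEquiv e

open CategoryTheory in
theorem isCohenMacaulayLocal_stalk_iff {X Y : Scheme.{u}} (f : X ⟶ Y) [IsOpenImmersion f] (x : X) :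
    IsCohenMacaulayLocal (Y.presheaf.stalk (f x)) ↔ IsCohenMacaulayLocal (X.presheaf.stalk x) :=
  let e := (asIso (f.stalkMap x)).commRingCatIsoToRingEquiv
  ⟨.of_ringEquiv e, .of_ringEquiv e.symm⟩

/-- If `I` and `J` agree on an affine open `U`, then over `U` both closed subschemes are
`Spec (Γ(X, U) / I(U))`, so they have the same stalks there. -/
theorem isCohenMacaulayLocal_stalk_subscheme {X : Scheme.{u}} {I J : X.IdealSheafData}
    (hJ : ∀ y : J.subscheme, IsCohenMacaulayLocal (J.subscheme.presheaf.stalk y))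
    (U : X.affineOpens) (hU : I.ideal U = J.ideal U) (x : I.subscheme)
    (hx : I.subschemeι x ∈ U.1) : IsCohenMacaulayLocal (I.subscheme.presheaf.stalk x) := by
  have : IsOpenImmersion (I.subschemeCover.f U) := I.subschemeCover.map_prop U
  have : IsOpenImmersion (J.subschemeCover.f U) := J.subschemeCover.map_prop U
  have key : ∀ y : Spec (.of (Γ(X, U) ⧸ J.ideal U)),
      IsCohenMacaulayLocal ((Spec (.of (Γ(X, U) ⧸ J.ideal U))).presheaf.stalk y) := fun y =>
    (isCohenMacaulayLocal_stalk_iff (J.subschemeCover.f U) y).mp (hJ _)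
  rw [← hU] at key
  obtain ⟨y, rfl⟩ : x ∈ (I.subschemeCover.f U).opensRange := by
    rw [I.opensRange_subschemeCover_map]; exact hx
  exact (isCohenMacaulayLocal_stalk_iff (I.subschemeCover.f U) y).mpr (key y)

/-! ### Ideal sheaves and their supports -/

/-- A function on an affine open `U` lies in the ideal of the reduced structure on `Z` exactly when
its nonvanishing locus misses `Z ∩ U`. -/
theorem mem_vanishingIdeal_ideal_iff {X : Scheme.{u}} (Z : Closeds X) (U : X.affineOpens)
    (f : Γ(X, U)) : f ∈ (Scheme.IdealSheafData.vanishingIdeal Z).ideal U ↔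
      ∀ x ∈ Z, x ∈ U.1 → x ∉ X.basicOpen f := by
  rw [Scheme.IdealSheafData.vanishingIdeal_ideal, PrimeSpectrum.mem_vanishingIdeal]
  have h (p : Spec Γ(X, U)) : f ∈ p.asIdeal ↔ U.2.fromSpec p ∉ X.basicOpen f := by
    have : p ∈ U.2.fromSpec ⁻¹ᵁ X.basicOpen f ↔ f ∉ p.asIdeal := by
      rw [U.2.fromSpec_preimage_basicOpen]; rfl
    rw [← not_iff_not, not_not, ← this]; rfl
  constructor
  · intro H x hxZ hxU
    obtain ⟨p, rfl⟩ : x ∈ Set.range U.2.fromSpec := by rwa [U.2.range_fromSpec]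
    exact (h p).mp (H p hxZ)
  · intro H p hp
    refine (h p).mpr (H _ hp ?_)
    have : U.2.fromSpec p ∈ Set.range U.2.fromSpec := ⟨p, rfl⟩
    rwa [U.2.range_fromSpec] at this

/-- The Nullstellensatz on an affine open, for the support of an ideal sheaf. -/
theorem mem_radical_ideal_iff {X : Scheme.{u}} (I : X.IdealSheafData) (U : X.affineOpens)
    (f : Γ(X, U)) : f ∈ (I.ideal U).radical ↔
      ∀ x ∈ I.support, x ∈ U.1 → x ∉ X.basicOpen f := by
  rw [← mem_vanishingIdeal_ideal_iff, Scheme.IdealSheafData.vanishingIdeal_support]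
  rfl

theorem ideal_eq_top_of_disjoint_support {X : Scheme.{u}} (I : X.IdealSheafData)
    (U : X.affineOpens) (h : ∀ x ∈ I.support, x ∉ U.1) : I.ideal U = ⊤ := by
  rw [← Ideal.radical_eq_top, Ideal.eq_top_iff_one, mem_radical_ideal_iff]
  exact fun x hx hxU => absurd hxU (h x hx)

/-- For disjoint supports, every point of `V(I ⊓ J)` has an affine neighbourhood on which one of the
two ideals is the unit ideal, and there `I ⊓ J` is the other one. -/
theorem isCohenMacaulayLocal_stalk_inf {X : Scheme.{u}} {I J : X.IdealSheafData}
    (hIJ : Disjoint I.support J.support)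
    (hI : ∀ y : I.subscheme, IsCohenMacaulayLocal (I.subscheme.presheaf.stalk y))
    (hJ : ∀ y : J.subscheme, IsCohenMacaulayLocal (J.subscheme.presheaf.stalk y))
    (x : (I ⊓ J).subscheme) : IsCohenMacaulayLocal ((I ⊓ J).subscheme.presheaf.stalk x) := by
  have hd (y : X) (h1 : y ∈ I.support) (h2 : y ∈ J.support) : False :=
    show y ∈ (⊥ : Closeds X) from hIJ.eq_bot ▸ ⟨h1, h2⟩
  have aux (K : X.IdealSheafData) (y : X) (hy : y ∉ K.support) :
      ∃ U : X.affineOpens, y ∈ U.1 ∧ K.ideal U = ⊤ := by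
    obtain ⟨_, ⟨U, hU, rfl⟩, hyU, hUK⟩ := X.isBasis_affineOpens.exists_subset_of_mem_open
      (show y ∈ (K.support : Set X)ᶜ from hy) K.support.isClosed.isOpen_compl
    exact ⟨⟨U, hU⟩, hyU, ideal_eq_top_of_disjoint_support K _ fun z hz hzU => hUK hzU hz⟩
  by_cases hx : (I ⊓ J).subschemeι x ∈ J.support
  · obtain ⟨U, hxU, hU⟩ := aux I _ fun h => hd _ h hx
    exact isCohenMacaulayLocal_stalk_subscheme hJ U (by simp [hU]) x hxU
  · obtain ⟨U, hxU, hU⟩ := aux J _ hx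
    exact isCohenMacaulayLocal_stalk_subscheme hI U (by simp [hU]) x hxU

/-! ### The union of two disjoint curves -/

theorem support_inf {X : Scheme.{u}} (I J : X.IdealSheafData) :
    (I ⊓ J).support = I.support ⊔ J.support := by
  rw [← Scheme.IdealSheafData.support_radical, Scheme.IdealSheafData.radical_inf,
    ← Scheme.IdealSheafData.radical_mul, Scheme.IdealSheafData.support_radical,
    Scheme.IdealSheafData.support_mul]

/-- An irreducible component of the union of two closed sets is a component of one of them. -/
theorem maximal_isIrreducible_of_union {T : Type*} [TopologicalSpace T] {A B Z : Set T}
    (hA : IsClosed A) (hB : IsClosed B)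
    (hZ : Maximal (fun W => IsIrreducible W ∧ W ⊆ A ∪ B) Z) :
    Maximal (fun W => IsIrreducible W ∧ W ⊆ A) Z ∨
      Maximal (fun W => IsIrreducible W ∧ W ⊆ B) Z := by
  refine (isPreirreducible_iff_isClosed_union_isClosed.mp hZ.prop.1.isPreirreducible A B hA hB
    hZ.prop.2).imp (fun h => ⟨⟨hZ.prop.1, h⟩, fun W hW => ?_⟩)
    (fun h => ⟨⟨hZ.prop.1, h⟩, fun W hW => ?_⟩)
  · exact hZ.2 ⟨hW.1, hW.2.trans Set.subset_union_left⟩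
  · exact hZ.2 ⟨hW.1, hW.2.trans Set.subset_union_right⟩

theorem IsCurve.inf {C D : (P3 k).IdealSheafData} (hC : IsCurve C) (hD : IsCurve D)
    (hCD : Disjoint C.support D.support) : IsCurve (C ⊓ D) where
  nonempty := by
    rw [support_inf, Closeds.coe_sup]
    exact hC.nonempty.inl
  locallyCohenMacaulay :=
    isCohenMacaulayLocal_stalk_inf hCD hC.locallyCohenMacaulay hD.locallyCohenMacaulay
  pureDimOne Z hZ := by
    rw [support_inf, Closeds.coe_sup] at hZ
    exact (maximal_isIrreducible_of_union C.support.isClosed D.support.isClosed hZ).elim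
      (hC.pureDimOne Z) (hD.pureDimOne Z)

/-! ### Functions on the standard charts -/

theorem mem_basicOpen_dehomogenize_iff {i : Fin 4} {n : ℕ} (F : grading k n) {x : P3 k}
    (hx : x ∈ (chart k i).1) :
    x ∈ (P3 k).basicOpen (dehomogenize i F) ↔ F.1 ∉ x.asHomogeneousIdeal := by
  rw [Scheme.mem_basicOpen _ _ _ hx]
  have h := congr($(ProjectiveSpectrum.Proj.awayToSection_germ (grading k) (MvPolynomial.X i) x hx)
    (fraction i F))
  have h' : (P3 k).presheaf.germ (chart k i).1 x hx (dehomogenize i F) =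
      (Proj.stalkIso (grading k) x).inv
        (HomogeneousLocalization.mapId (grading k) (Submonoid.powers_le.mpr hx) (fraction i F)) := h
  have := x.isPrime
  have h2 : IsUnit ((Proj.stalkIso (grading k) x).inv
      (HomogeneousLocalization.mapId (grading k) (Submonoid.powers_le.mpr hx) (fraction i F))) ↔
      IsUnit (HomogeneousLocalization.mapId (Q := x.asHomogeneousIdeal.toIdeal.primeCompl)
        (grading k) (Submonoid.powers_le.mpr hx) (fraction i F)) :=
    MulEquiv.isUnit_map (Proj.stalkIso (grading k) x).symm.commRingCatIsoToRingEquiv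
  have h3 : (HomogeneousLocalization.mapId (Q := x.asHomogeneousIdeal.toIdeal.primeCompl)
      (grading k) (Submonoid.powers_le.mpr hx) (fraction i F)).val =
      Localization.mk F.1 ⟨MvPolynomial.X i ^ n, Submonoid.pow_mem _ hx n⟩ := rfl
  rw [h']
  refine h2.trans ?_
  rw [← HomogeneousLocalization.isUnit_iff_isUnit_val, h3, Localization.mk_eq_mk',
    IsLocalization.AtPrime.isUnit_mk'_iff]
  rfl

theorem exists_eq_dehomogenize (i : Fin 4) (f : Γ(P3 k, (chart k i).1)) :
    ∃ (n : ℕ) (F : grading k n), f = dehomogenize i F := by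
  obtain ⟨z, rfl⟩ := (Proj.basicOpenIsoAway (grading k) (MvPolynomial.X i) (X_mem_grading i)
    one_pos).commRingCatIsoToRingEquiv.surjective f
  obtain ⟨n, a, ha, rfl⟩ := HomogeneousLocalization.Away.mk_surjective _ (X_mem_grading i) z
  exact ⟨n, ⟨a, by simpa using ha⟩, rfl⟩

/-! ### Linear forms and linear subspaces -/

theorem span_range_X :
    Submodule.span k (Set.range fun i : Fin 4 =>
      (⟨MvPolynomial.X i, X_mem_grading i⟩ : grading k 1)) = ⊤ := by
  apply Submodule.map_injective_of_injective (grading k 1).injective_subtype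
  rw [Submodule.map_span, ← Set.range_comp, Submodule.map_top, Submodule.range_subtype]
  exact (MvPolynomial.homogeneousSubmodule_one_eq_span_X).symm

theorem finrank_grading_one : Module.finrank k (grading k 1) = 4 := by
  have hli : LinearIndependent k (fun i : Fin 4 =>
      (⟨MvPolynomial.X i, X_mem_grading i⟩ : grading k 1)) := by
    refine LinearIndependent.of_comp (grading k 1).subtype ?_
    exact MvPolynomial.linearIndependent_X (Fin 4) k
  rw [← finrank_top, ← span_range_X, finrank_span_eq_card hli, Fintype.card_fin]

instance finite_grading (n : ℕ) : Module.Finite k (grading k n) :=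
  Module.Finite.iff_fg.mpr (MvPolynomial.homogeneousSubmodule_fg (Fin 4) k n)

section lift

variable {A : Type*} [CommRing A] [Algebra k A]

/-- The `k`-algebra homomorphism out of `k[x₀, x₁, x₂, x₃]` extending a linear map on linear
forms. -/
def liftForms (g : grading k 1 →ₗ[k] A) : MvPolynomial (Fin 4) k →ₐ[k] A :=
  MvPolynomial.aeval fun i => g ⟨MvPolynomial.X i, X_mem_grading i⟩

theorem liftForms_apply (g : grading k 1 →ₗ[k] A) (u : grading k 1) :
    liftForms g u.1 = g u := by
  have : (liftForms g).toLinearMap ∘ₗ (grading k 1).subtype = g := by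
    refine LinearMap.ext_on_range span_range_X fun i => ?_
    simp [liftForms]
  exact congr($this u)

end lift

/-- A substitution of linear forms for the variables preserves degrees, so its kernel is a
homogeneous ideal. -/
theorem isHomogeneous_ker_aeval (v : Fin 4 → grading k 1) :
    (RingHom.ker (MvPolynomial.aeval (R := k) fun i => (v i).1)).IsHomogeneous (grading k) := by
  intro n F hF
  have hmem (m : ℕ) (G : MvPolynomial (Fin 4) k) (hG : G ∈ grading k m) :
      MvPolynomial.aeval (fun i => (v i).1) G ∈ grading k m := by
    simpa using MvPolynomial.IsHomogeneous.aeval (n := 1) (m := m) hG _ fun i => (v i).2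
  let f : grading k →+*ᵍ grading k :=
    { (MvPolynomial.aeval (R := k) fun i => (v i).1).toRingHom with map_mem := hmem _ _ }
  rw [RingHom.mem_ker] at hF ⊢
  have h1 := f.map_directSumDecompose (x := F) (i := n)
  change MvPolynomial.aeval (fun i => (v i).1) _ = _ at h1
  rw [h1]
  change (DirectSum.decompose (grading k) (MvPolynomial.aeval (fun i => (v i).1) F) n).1 = 0
  rw [hF, DirectSum.decompose_zero]
  rfl

/-- The point of `ℙ³` whose homogeneous prime ideal is the kernel of the substitution
`u ↦ g u` on linear forms, for a nonzero endomorphism `g`: the generic point of the linear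
subspace on which `ker g` vanishes. -/
def genericPoint (g : grading k 1 →ₗ[k] grading k 1) (hg : g ≠ 0) : P3 k where
  asHomogeneousIdeal := ⟨RingHom.ker (liftForms ((grading k 1).subtype ∘ₗ g)),
    isHomogeneous_ker_aeval fun i => g ⟨MvPolynomial.X i, X_mem_grading i⟩⟩
  isPrime := RingHom.ker_isPrime _
  not_irrelevant_le h := by
    refine hg (LinearMap.ext fun u => ?_)
    have hu : u.1 ∈ HomogeneousIdeal.irrelevant (grading k) := by
      rw [HomogeneousIdeal.mem_irrelevant_iff, GradedRing.proj_apply,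
        DirectSum.decompose_of_mem_ne _ u.2 one_ne_zero]
    have := h hu
    have h2 : liftForms ((grading k 1).subtype ∘ₗ g) u.1 = 0 := this
    rw [liftForms_apply] at h2
    exact Subtype.ext h2

theorem mem_genericPoint_iff {g : grading k 1 →ₗ[k] grading k 1} {hg : g ≠ 0}
    {F : MvPolynomial (Fin 4) k} : F ∈ (genericPoint g hg).asHomogeneousIdeal ↔
      liftForms ((grading k 1).subtype ∘ₗ g) F = 0 := Iff.rfl

theorem form_mem_genericPoint_iff {g : grading k 1 →ₗ[k] grading k 1} {hg : g ≠ 0}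
    (u : grading k 1) : u.1 ∈ (genericPoint g hg).asHomogeneousIdeal ↔ g u = 0 := by
  rw [mem_genericPoint_iff, liftForms_apply]
  simp

/-- The equations of two disjoint lines together form a basis of the linear forms: otherwise some
nonzero functional `f` kills all four of them, and the point with `u ↦ f u • x₀` as substitution
lies on both lines. -/
theorem isCompl_span_of_disjoint_zeroLocus {a b c d : grading k 1}
    (hab : LinearIndependent k ![a, b]) (hcd : LinearIndependent k ![c, d])
    (h : Disjoint (ProjectiveSpectrum.zeroLocus (grading k) {a.1, b.1})
      (ProjectiveSpectrum.zeroLocus (grading k) {c.1, d.1})) :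
    IsCompl (Submodule.span k {a, b}) (Submodule.span k {c, d}) := by
  have hsup : Submodule.span k {a, b} ⊔ Submodule.span k {c, d} = ⊤ := by
    by_contra hne
    obtain ⟨f, hf, hle⟩ := Submodule.exists_le_ker_of_lt_top _ (lt_top_iff_ne_top.mpr hne)
    let g : grading k 1 →ₗ[k] grading k 1 :=
      f.smulRight ⟨MvPolynomial.X 0, X_mem_grading 0⟩
    have hg0 (u : grading k 1) : g u = 0 ↔ f u = 0 := by
      simp [g, Subtype.ext_iff]
    have hg : g ≠ 0 := fun h0 => hf (LinearMap.ext fun u => (hg0 u).mp (by rw [h0]; rfl))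
    have hz (u : grading k 1) (hu : u ∈ Submodule.span k {a, b} ⊔ Submodule.span k {c, d}) :
        u.1 ∈ (genericPoint g hg).asHomogeneousIdeal :=
      (form_mem_genericPoint_iff u).mpr ((hg0 u).mpr (hle hu))
    have h1 : genericPoint g hg ∈ ProjectiveSpectrum.zeroLocus (grading k) {a.1, b.1} := by
      rintro _ (rfl | rfl) <;>
        exact hz _ (Submodule.mem_sup_left (Submodule.subset_span (by simp)))
    have h2 : genericPoint g hg ∈ ProjectiveSpectrum.zeroLocus (grading k) {c.1, d.1} := by
      rintro _ (rfl | rfl) <;>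
        exact hz _ (Submodule.mem_sup_right (Submodule.subset_span (by simp)))
    exact Set.disjoint_left.mp h h1 h2
  -- Two planes spanning a four-dimensional space meet in zero.
  have hrank {u v : grading k 1} (huv : LinearIndependent k ![u, v]) :
      Module.finrank k (Submodule.span k {u, v}) = 2 := by
    rw [← Matrix.range_cons_cons_empty u v ![], finrank_span_eq_card huv, Fintype.card_fin]
  refine ⟨?_, codisjoint_iff.mpr hsup⟩
  rw [disjoint_iff, ← Submodule.finrank_eq_zero (R := k)]
  have := Submodule.finrank_sup_add_finrank_inf_eq (Submodule.span k {a, b})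
    (Submodule.span k {c, d})
  rw [hsup, finrank_top, finrank_grading_one, hrank hab, hrank hcd] at this
  omega

/-! ### Order of a form along a line -/

section weight

open Polynomial

/-- The substitution `u ↦ g u + t h u` on linear forms, with values in `k[x₀, x₁, x₂, x₃][t]`. -/
def pencil (g h : grading k 1 →ₗ[k] grading k 1) :
    MvPolynomial (Fin 4) k →ₐ[k] (MvPolynomial (Fin 4) k)[X] :=
  liftForms ((Polynomial.CAlgHom (R := k) (A := MvPolynomial (Fin 4) k)).toLinearMap ∘ₗ
      (grading k 1).subtype ∘ₗ g +
    LinearMap.mulLeft k (X : (MvPolynomial (Fin 4) k)[X]) ∘ₗ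
      (Polynomial.CAlgHom (R := k) (A := MvPolynomial (Fin 4) k)).toLinearMap ∘ₗ
      (grading k 1).subtype ∘ₗ h)

variable {g h : grading k 1 →ₗ[k] grading k 1}

theorem pencil_apply (u : grading k 1) :
    pencil g h u.1 = C (g u).1 + X * C (h u).1 := by
  rw [pencil, liftForms_apply]
  simp

/-- Setting `t = 0` in `pencil g h` leaves the substitution `u ↦ g u`. -/
theorem coeff_zero_pencil (F : MvPolynomial (Fin 4) k) :
    (pencil g h F).coeff 0 = liftForms ((grading k 1).subtype ∘ₗ g) F := by
  have : ((Polynomial.aeval (R := MvPolynomial (Fin 4) k)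
      (0 : MvPolynomial (Fin 4) k)).restrictScalars k).comp (pencil g h) =
      liftForms ((grading k 1).subtype ∘ₗ g) := by
    ext1 i
    have := pencil_apply (g := g) (h := h) ⟨MvPolynomial.X i, X_mem_grading i⟩
    have h2 := liftForms_apply ((grading k 1).subtype ∘ₗ g) ⟨MvPolynomial.X i, X_mem_grading i⟩
    simp only at this h2
    simp [this, h2]
  rw [← this, AlgHom.comp_apply, coeff_zero_eq_aeval_zero]
  rfl

theorem eval_one_pencil (hgh : g + h = LinearMap.id) (F : MvPolynomial (Fin 4) k) :
    (pencil g h F).eval 1 = F := by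
  have : ((Polynomial.aeval (R := MvPolynomial (Fin 4) k)
      (1 : MvPolynomial (Fin 4) k)).restrictScalars k).comp (pencil g h) = AlgHom.id k _ := by
    ext1 i
    have h1 := pencil_apply (g := g) (h := h) ⟨MvPolynomial.X i, X_mem_grading i⟩
    have h2 := congr(($hgh ⟨MvPolynomial.X i, X_mem_grading i⟩).1)
    simp only at h1
    simpa [h1] using h2
  exact congr($this F)

/-- On forms of degree `n`, exchanging `g` and `h` reverses the coefficients in `t`. -/
theorem natDegree_pencil_le_and_reflect {n : ℕ} {F : MvPolynomial (Fin 4) k}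
    (hF : F ∈ grading k n) :
    (pencil g h F).natDegree ≤ n ∧ (pencil g h F).reflect n = pencil h g F := by
  rw [grading, ← MvPolynomial.homogeneousSubmodule_one_pow] at hF
  induction hF using Submodule.pow_induction_on_left' with
  | algebraMap r =>
    rw [AlgHom.commutes, AlgHom.commutes]
    simp [IsScalarTower.algebraMap_apply k (MvPolynomial (Fin 4) k) (MvPolynomial (Fin 4) k)[X],
      Polynomial.algebraMap_eq]
  | add x y i hx hy ihx ihy =>
    rw [map_add, map_add, reflect_add, ihx.2, ihy.2]
    exact ⟨natDegree_add_le_of_degree_le ihx.1 ihy.1, rfl⟩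
  | mem_mul u hu i x hx ih =>
    have h1 : (pencil g h u).natDegree ≤ 1 := by
      rw [pencil_apply ⟨u, hu⟩]; compute_degree
    have h2 : (pencil g h u).reflect 1 = pencil h g u := by
      rw [pencil_apply ⟨u, hu⟩, pencil_apply ⟨u, hu⟩, reflect_add, reflect_C, mul_comm X,
        reflect_C_mul, reflect_one_X]
      ring
    rw [map_mul, map_mul, Nat.succ_eq_add_one, add_comm i 1, reflect_mul _ _ h1 ih.1, h2, ih.2]
    exact ⟨natDegree_mul_le_of_le h1 ih.1, rfl⟩

/-- In coordinates adapted to `g + h = id`, a monomial of `F` would have degree at least `p` in one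
set of variables and at least `q` in the other, which is impossible when `deg F < p + q`. -/
theorem eq_zero_of_X_pow_dvd_pencil (hgh : g + h = LinearMap.id) {n p q : ℕ} (hn : n < p + q)
    {F : MvPolynomial (Fin 4) k} (hF : F ∈ grading k n) (hp : X ^ p ∣ pencil g h F)
    (hq : X ^ q ∣ pencil h g F) : F = 0 := by
  rw [← eval_one_pencil hgh F]
  suffices pencil g h F = 0 by rw [this, eval_zero]
  obtain ⟨hdeg, hrefl⟩ := natDegree_pencil_le_and_reflect (g := g) (h := h) hF
  rw [X_pow_dvd_iff] at hp hq
  ext1 j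
  rw [coeff_zero]
  -- The coefficient of `t ^ j` vanishes by `hp` for `j < p`, by `hq` for `p ≤ j ≤ n`, and by degree
  -- for `n < j`.
  by_cases hj : j < p
  · exact hp j hj
  by_cases hjn : j ≤ n
  · have := hq (n - j) (by omega)
    rwa [← hrefl, coeff_reflect, revAt_le (Nat.sub_le _ _), Nat.sub_sub_self hjn] at this
  · exact coeff_eq_zero_of_natDegree_lt (by omega)

end weight

/-! ### Forms vanishing on a subscheme -/

theorem fraction_mul (i : Fin 4) {m n : ℕ} (F : grading k m) (G : grading k n) :
    fraction i (⟨F.1 * G.1, SetLike.mul_mem_graded F.2 G.2⟩ : grading k (m + n)) =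
      fraction i F * fraction i G := by
  apply HomogeneousLocalization.val_injective
  simp [fraction, HomogeneousLocalization.Away.val_mk, Localization.mk_mul, pow_add]

theorem dehomogenize_mul (i : Fin 4) {m n : ℕ} (F : grading k m) (G : grading k n) :
    dehomogenize i (⟨F.1 * G.1, SetLike.mul_mem_graded F.2 G.2⟩ : grading k (m + n)) =
      dehomogenize i F * dehomogenize i G :=
  (congrArg _ (fraction_mul i F G)).trans (map_mul _ _ _)

theorem dehomogenize_pow (i : Fin 4) (F : grading k 1) (n : ℕ) :
    dehomogenize i (⟨F.1 ^ n, by simpa using SetLike.pow_mem_graded n F.2⟩ : grading k n) =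
      dehomogenize i F ^ n := by
  have : fraction i (⟨F.1 ^ n, by simpa using SetLike.pow_mem_graded n F.2⟩ : grading k n) =
      fraction i F ^ n := by
    apply HomogeneousLocalization.val_injective
    simp [fraction, HomogeneousLocalization.Away.val_mk, Localization.mk_pow]
  exact (congrArg _ this).trans (map_pow _ _ _)

/-- The forms of degree `n` that vanish on `C`, as polynomials. -/
def vanishingForms (C : (P3 k).IdealSheafData) (n : ℕ) : Submodule k (MvPolynomial (Fin 4) k) :=
  (sectionsTwist C n).map (grading k n).subtype

theorem coe_mem_vanishingForms {C : (P3 k).IdealSheafData} {n : ℕ} (F : grading k n) :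
    F.1 ∈ vanishingForms C n ↔ F ∈ sectionsTwist C n := by
  refine ⟨?_, fun h => ⟨F, h, rfl⟩⟩
  rintro ⟨G, hG, hGF⟩
  rwa [← Subtype.ext (a1 := G) (a2 := F) hGF]

theorem grading_mul_vanishingForms_le (C : (P3 k).IdealSheafData) (m n : ℕ) :
    grading k m * vanishingForms C n ≤ vanishingForms C (m + n) := by
  rw [Submodule.mul_le]
  rintro F hF _ ⟨G, hG, rfl⟩
  refine (coe_mem_vanishingForms ⟨F * G.1, SetLike.mul_mem_graded hF G.2⟩).mpr fun i => ?_
  rw [dehomogenize_mul i ⟨F, hF⟩ G]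
  exact Ideal.mul_mem_left _ _ (hG i)

theorem grading_mul_grading (m n : ℕ) : grading k m * grading k n = grading k (m + n) := by
  have h (r : ℕ) := MvPolynomial.homogeneousSubmodule_one_pow (σ := Fin 4) (R := k) r
  change MvPolynomial.homogeneousSubmodule (Fin 4) k m * MvPolynomial.homogeneousSubmodule _ k n =
    MvPolynomial.homogeneousSubmodule _ k (m + n)
  rw [← h m, ← h n, ← h (m + n), pow_add]

/-- Let `T` be stable under multiplication by forms. In the binomial expansion of
`(A + B) ^ (p + q)` every term contains `A ^ p` or `B ^ q`. -/
theorem sup_pow_add_le {T : ℕ → Submodule k (MvPolynomial (Fin 4) k)}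
    (hT : ∀ m n, grading k m * T n ≤ T (m + n)) {A B : Submodule k (MvPolynomial (Fin 4) k)}
    (hA : A ≤ grading k 1) (hB : B ≤ grading k 1) {p q : ℕ} (hAp : A ^ p ≤ T p)
    (hBq : B ^ q ≤ T q) : (A ⊔ B) ^ (p + q) ≤ T (p + q) := by
  have hpow {E : Submodule k (MvPolynomial (Fin 4) k)} (hE : E ≤ grading k 1) (n : ℕ) :
      E ^ n ≤ grading k n := by
    rw [grading, ← MvPolynomial.homogeneousSubmodule_one_pow]
    exact pow_le_pow_left' hE n
  have hterm {E E' : Submodule k (MvPolynomial (Fin 4) k)} (hE : E ≤ grading k 1)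
      (hE' : E' ≤ grading k 1) {r i j : ℕ} (hr : E ^ r ≤ T r) (hri : r ≤ i) :
      E ^ i * E' ^ j ≤ T (i + j) := by
    obtain ⟨s, rfl⟩ := Nat.exists_eq_add_of_le hri
    calc E ^ (r + s) * E' ^ j = (E ^ s * E' ^ j) * E ^ r := by rw [pow_add]; ring
      _ ≤ (grading k s * grading k j) * T r :=
        mul_le_mul' (mul_le_mul' (hpow hE s) (hpow hE' j)) hr
      _ ≤ T (r + s + j) := by
        rw [grading_mul_grading, add_assoc, add_comm r]
        exact hT _ _
  rw [← Submodule.add_eq_sup, add_pow]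
  refine Finset.sum_induction _ (· ≤ T (p + q)) (fun _ _ => sup_le) bot_le fun i hi => ?_
  have hi' : i ≤ p + q := Nat.lt_succ_iff.mp (Finset.mem_range.mp hi)
  -- Addition of submodules is idempotent, so the binomial coefficients do not matter.
  have hcast (E : Submodule k (MvPolynomial (Fin 4) k)) (n : ℕ) : E * (n : ℕ) ≤ E := by
    induction n with
    | zero => simp
    | succ n ih =>
      rw [Nat.cast_succ, mul_add, mul_one, Submodule.add_eq_sup]
      exact sup_le ih le_rfl
  refine (hcast _ _).trans ?_
  by_cases hpi : p ≤ i
  · exact (hterm hA hB hAp hpi).trans_eq (by congr 1; omega)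
  · rw [mul_comm]
    exact (hterm hB hA hBq (by omega)).trans_eq (by congr 1; omega)

/-- A linear form vanishing on the support of `C` has a power that vanishes on `C` itself. -/
theorem exists_pow_mem_vanishingForms (C : (P3 k).IdealSheafData) (u : grading k 1)
    (hu : ∀ x ∈ C.support, u.1 ∈ x.asHomogeneousIdeal) :
    ∃ n, u.1 ^ n ∈ vanishingForms C n := by
  have h (i : Fin 4) : ∃ n, dehomogenize i u ^ n ∈ C.ideal (chart k i) := by
    refine (mem_radical_ideal_iff C (chart k i) (dehomogenize i u)).mpr fun x hx hxi => ?_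
    rw [mem_basicOpen_dehomogenize_iff u hxi, not_not]
    exact hu x hx
  choose n hn using h
  refine ⟨Finset.univ.sup n, (coe_mem_vanishingForms ⟨u.1 ^ _, ?_⟩).mpr fun i => ?_⟩
  · simpa using SetLike.pow_mem_graded _ u.2
  · rw [dehomogenize_pow]
    exact (C.ideal _).pow_mem_of_pow_mem (hn i) (Finset.le_sup (Finset.mem_univ i))

theorem exists_span_pow_le_vanishingForms (C : (P3 k).IdealSheafData) {a b : grading k 1}
    (hC : (C.support : Set (P3 k)) = ProjectiveSpectrum.zeroLocus (grading k) {a.1, b.1}) :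
    ∃ n, Submodule.span k {a.1, b.1} ^ n ≤ vanishingForms C n := by
  have hsub {x : P3 k} (hx : x ∈ C.support) :
      x ∈ ProjectiveSpectrum.zeroLocus (grading k) {a.1, b.1} := by
    rw [← hC]; exact hx
  obtain ⟨p, hp⟩ := exists_pow_mem_vanishingForms C a fun x hx => hsub hx (by simp)
  obtain ⟨q, hq⟩ := exists_pow_mem_vanishingForms C b fun x hx => hsub hx (by simp)
  refine ⟨p + q, ?_⟩
  rw [Submodule.span_insert]
  refine sup_pow_add_le (grading_mul_vanishingForms_le C) ?_ ?_ ?_ ?_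
  · rw [Submodule.span_singleton_le_iff_mem]; exact a.2
  · rw [Submodule.span_singleton_le_iff_mem]; exact b.2
  · rwa [Submodule.span_pow, Set.singleton_pow, Submodule.span_singleton_le_iff_mem]
  · rwa [Submodule.span_pow, Set.singleton_pow, Submodule.span_singleton_le_iff_mem]

/-- Two subschemes supported on disjoint lines impose independent conditions on forms of large
degree. -/
theorem eventually_sectionsTwist_sup_eq_top {C D : (P3 k).IdealSheafData} {a b c d : grading k 1}
    (hC : (C.support : Set (P3 k)) = ProjectiveSpectrum.zeroLocus (grading k) {a.1, b.1})
    (hD : (D.support : Set (P3 k)) = ProjectiveSpectrum.zeroLocus (grading k) {c.1, d.1})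
    (h : Submodule.span k {a, b} ⊔ Submodule.span k {c, d} = ⊤) :
    ∀ᶠ n in Filter.atTop, sectionsTwist C n ⊔ sectionsTwist D n = ⊤ := by
  obtain ⟨p, hp⟩ := exists_span_pow_le_vanishingForms C hC
  obtain ⟨q, hq⟩ := exists_span_pow_le_vanishingForms D hD
  let T (n : ℕ) := vanishingForms C n ⊔ vanishingForms D n
  have hT (m n : ℕ) : grading k m * T n ≤ T (m + n) := by
    rw [Submodule.mul_sup]
    exact sup_le_sup (grading_mul_vanishingForms_le C m n) (grading_mul_vanishingForms_le D m n)
  have hspan : Submodule.span k {a.1, b.1} ⊔ Submodule.span k {c.1, d.1} = grading k 1 := by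
    have := congrArg (Submodule.map (grading k 1).subtype) h
    rwa [Submodule.map_sup, Submodule.map_span, Submodule.map_span, Set.image_pair, Set.image_pair,
      Submodule.map_top, Submodule.range_subtype] at this
  have hpq : grading k (p + q) ≤ T (p + q) := by
    rw [grading, ← MvPolynomial.homogeneousSubmodule_one_pow]
    change (grading k 1) ^ (p + q) ≤ _
    rw [← hspan]
    exact sup_pow_add_le hT (le_sup_left.trans_eq hspan) (le_sup_right.trans_eq hspan)
      (hp.trans le_sup_left) (hq.trans le_sup_right)
  filter_upwards [Filter.eventually_ge_atTop (p + q)] with n hn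
  apply Submodule.map_injective_of_injective (grading k n).injective_subtype
  rw [Submodule.map_sup, Submodule.map_top, Submodule.range_subtype]
  refine le_antisymm (sup_le ?_ ?_) ?_
  · exact Submodule.map_subtype_le _ _
  · exact Submodule.map_subtype_le _ _
  · obtain ⟨r, rfl⟩ := Nat.exists_eq_add_of_le' hn
    exact (grading_mul_grading r (p + q)).ge.trans <| (mul_le_mul' le_rfl hpq).trans (hT r (p + q))

/-! ### Hilbert function and genus -/

theorem sectionsTwist_inf (C D : (P3 k).IdealSheafData) (n : ℕ) :
    sectionsTwist (C ⊓ D) n = sectionsTwist C n ⊓ sectionsTwist D n := by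
  ext F
  exact forall_and

theorem hilbertFunction_inf_of_sup_eq_top {C D : (P3 k).IdealSheafData} {n : ℕ}
    (h : sectionsTwist C n ⊔ sectionsTwist D n = ⊤) :
    hilbertFunction (C ⊓ D) n = hilbertFunction C n + hilbertFunction D n := by
  have h1 := Submodule.finrank_sup_add_finrank_inf_eq (sectionsTwist C n) (sectionsTwist D n)
  have h2 (E : Submodule k (grading k n)) := Submodule.finrank_quotient_add_finrank E
  rw [h, finrank_top] at h1
  have hC := h2 (sectionsTwist C n)
  have hD := h2 (sectionsTwist D n)
  have hCD := h2 (sectionsTwist C n ⊓ sectionsTwist D n)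
  rw [← sectionsTwist_inf] at hCD h1
  unfold hilbertFunction
  omega

theorem beorchiaBound_self (d : ℕ) (hd : 1 ≤ d) :
    beorchiaBound d d = 1 - (d : ℤ) - (d.choose 3 : ℤ) := by
  obtain ⟨e, rfl⟩ := Nat.exists_eq_add_of_le' hd
  rw [beorchiaBound, if_pos (by omega)]
  have h1 : (e + 1 + 2).choose 3 = (e + 1).choose 3 + 2 * (e + 1).choose 2 + (e + 1) := by
    simp [Nat.choose_succ_succ' (e + 1 + 1), Nat.choose_succ_succ' (e + 1)]
    ring
  have h2 : 2 * (e + 1).choose 2 = (e + 1) * e := by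
    rw [mul_comm 2, ← Nat.add_sub_cancel (n := e) (m := 1), Nat.add_sub_cancel,
      Nat.choose_two_right, Nat.add_sub_cancel,
      Nat.div_mul_cancel (by simpa [mul_comm] using (Nat.even_mul_succ_self e).two_dvd)]
  rw [h1, h2]
  push_cast
  ring

/-- The genus of a disjoint union: this is the Vandermonde identity for `(p + q).choose 3`. -/
theorem beorchiaBound_add (p q : ℕ) (hp : 1 ≤ p) (hq : 1 ≤ q) :
    beorchiaBound (p + q) (p + q) =
      (beorchiaBound p p - (q : ℤ) * (p.choose 2 : ℤ)) +
        (beorchiaBound q q - (p : ℤ) * (q.choose 2 : ℤ)) - 1 := by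
  rw [beorchiaBound_self _ hp, beorchiaBound_self _ hq, beorchiaBound_self _ (by omega),
    Nat.add_choose_eq]
  simp [Finset.sum_range_succ, Finset.Nat.sum_antidiagonal_eq_sum_range_succ_mk]
  ring

/-! ### Sections of powers of the ideal of a line -/

section chartLift

variable {A : Type u} [CommRing A]

/-- The ring homomorphism from functions on the chart `D₊(xᵢ)` to `A[1/ψ(xᵢ)]`
induced by a ring homomorphism `ψ : k[x₀, x₁, x₂, x₃] → A`. -/
def chartLift (ψ : MvPolynomial (Fin 4) k →+* A) (i : Fin 4) :
    Γ(P3 k, (chart k i).1) →+* Localization.Away (ψ (MvPolynomial.X i)) :=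
  ((Localization.awayMap ψ (MvPolynomial.X i)).comp
    (algebraMap (HomogeneousLocalization.Away (grading k) (MvPolynomial.X i)) _)).comp
    (Proj.basicOpenIsoAway (grading k) (MvPolynomial.X i) (X_mem_grading i)
      one_pos).commRingCatIsoToRingEquiv.symm.toRingHom

theorem chartLift_dehomogenize (ψ : MvPolynomial (Fin 4) k →+* A) (i : Fin 4) {n : ℕ}
    (F : grading k n) :
    chartLift ψ i (dehomogenize i F) * algebraMap A _ (ψ (MvPolynomial.X i) ^ n) =
      algebraMap A _ (ψ F.1) := by
  have h1 : (Proj.basicOpenIsoAway (grading k) (MvPolynomial.X i) (X_mem_grading i)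
      one_pos).commRingCatIsoToRingEquiv.symm (dehomogenize i F) = fraction i F :=
    (Proj.basicOpenIsoAway (grading k) (MvPolynomial.X i) (X_mem_grading i)
      one_pos).commRingCatIsoToRingEquiv.symm_apply_apply (fraction i F)
  have h2 : chartLift ψ i (dehomogenize i F) =
      Localization.awayMap ψ (MvPolynomial.X i) (fraction i F).val :=
    congrArg (fun z => Localization.awayMap ψ (MvPolynomial.X i)
      (HomogeneousLocalization.val z)) h1
  have h3 : (fraction i F).val * algebraMap (MvPolynomial (Fin 4) k) _ (MvPolynomial.X i ^ n) =
      algebraMap (MvPolynomial (Fin 4) k) _ F.1 := by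
    rw [fraction, HomogeneousLocalization.Away.val_mk, Localization.mk_eq_mk']
    exact IsLocalization.mk'_spec _ F.1
      (⟨MvPolynomial.X i ^ n, n, rfl⟩ : Submonoid.powers (MvPolynomial.X i))
  have h4 := congrArg (Localization.awayMap ψ (MvPolynomial.X i)) h3
  rw [map_mul, ← h2] at h4
  simpa [Localization.awayMap, IsLocalization.Away.map] using h4

end chartLift

open Polynomial in
/-- Forms in `H⁰(I_L ^ e (n))` have order at least `e` along `L`. The order is read off on a chart
containing the generic point of `L`, after inverting `pencil g h xᵢ`, which is prime to `t`. -/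
theorem X_pow_dvd_pencil_of_mem_sectionsTwist {g h : grading k 1 →ₗ[k] grading k 1} (hg : g ≠ 0)
    {L : Closeds (P3 k)} (hL : genericPoint g hg ∈ L) {e n : ℕ} {F : grading k n}
    (hF : F ∈ sectionsTwist (Scheme.IdealSheafData.vanishingIdeal L ^ e) n) :
    X ^ e ∣ pencil g h F.1 := by
  obtain ⟨i, hi⟩ : ∃ i, g ⟨MvPolynomial.X i, X_mem_grading i⟩ ≠ 0 := by
    by_contra! H
    exact hg (LinearMap.ext_on_range span_range_X fun i => by simpa using H i)
  have hchart : genericPoint g hg ∈ (chart k i).1 := fun hmem =>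
    hi ((form_mem_genericPoint_iff (hg := hg) ⟨MvPolynomial.X i, X_mem_grading i⟩).mp hmem)
  have hdvd {r : ℕ} (G : grading k r) :
      X ∣ pencil g h G.1 ↔ G.1 ∈ (genericPoint g hg).asHomogeneousIdeal := by
    rw [X_dvd_iff, coeff_zero_pencil, mem_genericPoint_iff]
  have hXi : ¬ X ∣ pencil g h (MvPolynomial.X i) := fun H =>
    hchart ((hdvd ⟨MvPolynomial.X i, X_mem_grading i⟩).mp H)
  let ψ : MvPolynomial (Fin 4) k →+* (MvPolynomial (Fin 4) k)[X] := pencil g h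
  let t : Localization.Away (ψ (MvPolynomial.X i)) := algebraMap (MvPolynomial (Fin 4) k)[X] _ X
  have hunit (r : ℕ) : IsUnit (algebraMap (MvPolynomial (Fin 4) k)[X]
      (Localization.Away (ψ (MvPolynomial.X i)))
      (ψ (MvPolynomial.X i) ^ r)) := by
    rw [map_pow]
    exact (IsLocalization.Away.algebraMap_isUnit _).pow r
  have hle : (Scheme.IdealSheafData.vanishingIdeal L).ideal (chart k i) ≤
      (Ideal.span {t}).comap (chartLift ψ i) := by
    intro f hf
    obtain ⟨r, G, rfl⟩ := exists_eq_dehomogenize i f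
    have hG := (mem_vanishingIdeal_ideal_iff _ _ _).mp hf _ hL hchart
    rw [mem_basicOpen_dehomogenize_iff G hchart, not_not, ← hdvd] at hG
    rw [Ideal.mem_comap, Ideal.mem_span_singleton, ← (hunit r).dvd_mul_right,
      chartLift_dehomogenize]
    exact map_dvd (algebraMap _ _) hG
  have hFt : t ^ e ∣ chartLift ψ i (dehomogenize i F) := by
    rw [← Ideal.mem_span_singleton, ← Ideal.span_singleton_pow, ← Ideal.mem_comap]
    exact (Ideal.pow_right_mono hle e).trans (Ideal.le_comap_pow _ e) (hF i)
  have hloc : t ^ e ∣ algebraMap _ _ (ψ F.1) := by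
    rw [← chartLift_dehomogenize]
    exact hFt.mul_right _
  obtain ⟨y, hy⟩ := hloc
  obtain ⟨⟨z, s⟩, hz⟩ := IsLocalization.surj (Submonoid.powers (ψ (MvPolynomial.X i))) y
  obtain ⟨r, hr⟩ := s.2
  have hψi : ψ (MvPolynomial.X i) ≠ 0 := fun h0 => hXi (by
    change X ∣ ψ (MvPolynomial.X i); rw [h0]; exact dvd_zero _)
  have hinj : Function.Injective (algebraMap (MvPolynomial (Fin 4) k)[X]
      (Localization.Away (ψ (MvPolynomial.X i)))) :=
    IsLocalization.injective _ (powers_le_nonZeroDivisors_of_noZeroDivisors hψi)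
  have hmul : ψ F.1 * ψ (MvPolynomial.X i) ^ r = X ^ e * z := by
    apply hinj
    dsimp only at hr hz
    rw [map_mul, hy, hr, mul_assoc, hz, map_mul, map_pow]
  refine prime_X.pow_dvd_of_dvd_mul_right e (fun H => hXi (prime_X.dvd_of_dvd_pow H)) ⟨z, hmul⟩

/-- No nonzero form of degree less than `p + q` has order `p` along a line and order `q` along a
second line disjoint from the first. -/
theorem sectionsTwist_vanishingIdeal_pow_inf_eq_bot {L M : Closeds (P3 k)} {a b c d : grading k 1}
    (hL : (L : Set (P3 k)) = ProjectiveSpectrum.zeroLocus (grading k) {a.1, b.1})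
    (hM : (M : Set (P3 k)) = ProjectiveSpectrum.zeroLocus (grading k) {c.1, d.1})
    (hab : LinearIndependent k ![a, b]) (hcd : LinearIndependent k ![c, d])
    (h : IsCompl (Submodule.span k {a, b}) (Submodule.span k {c, d})) {p q n : ℕ}
    (hn : n < p + q) :
    sectionsTwist (Scheme.IdealSheafData.vanishingIdeal L ^ p) n ⊓
      sectionsTwist (Scheme.IdealSheafData.vanishingIdeal M ^ q) n = ⊥ := by
  -- If `g` is the projection with kernel the equations of a line, then `genericPoint g` lies on it.
  have aux {A B : Submodule k (grading k 1)} (hAB : IsCompl A B) {u v : grading k 1}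
      (hB : B = Submodule.span k {u, v}) (hA : A ≠ ⊥) {Z : Closeds (P3 k)}
      (hZ : (Z : Set (P3 k)) = ProjectiveSpectrum.zeroLocus (grading k) {u.1, v.1}) :
      ∃ hg : (A.projection B hAB) ≠ 0, genericPoint (A.projection B hAB) hg ∈ Z := by
    have hker (w : grading k 1) : (A.projection B hAB) w = 0 ↔ w ∈ B := by
      rw [← LinearMap.mem_ker, Submodule.ker_projection]
    refine ⟨fun h0 => hA ?_, ?_⟩
    · have hBtop : B = ⊤ := Submodule.eq_top_iff'.mpr fun w => (hker w).mp (by rw [h0]; rfl)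
      rw [hBtop] at hAB
      exact hAB.disjoint.eq_bot_of_le le_top
    · rw [← SetLike.mem_coe, hZ]
      rintro _ (rfl | rfl)
      · exact (form_mem_genericPoint_iff u).mpr
          ((hker u).mpr (hB ▸ Submodule.subset_span (by simp)))
      · exact (form_mem_genericPoint_iff v).mpr
          ((hker v).mpr (hB ▸ Submodule.subset_span (by simp)))
  have hne {u v : grading k 1} (huv : LinearIndependent k ![u, v]) :
      Submodule.span k {u, v} ≠ ⊥ := fun h0 =>
    huv.ne_zero 0 ((Submodule.mem_bot k).mp (h0 ▸ Submodule.subset_span (by simp)))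
  obtain ⟨hgL, hL'⟩ := aux h.symm rfl (hne hcd) hL
  obtain ⟨hgM, hM'⟩ := aux h rfl (hne hab) hM
  rw [eq_bot_iff]
  rintro F ⟨hFL, hFM⟩
  exact (Submodule.mem_bot k).mpr <| Subtype.ext <|
    eq_zero_of_X_pow_dvd_pencil (Submodule.projection_add_projection_eq_id h.symm) hn F.2
      (X_pow_dvd_pencil_of_mem_sectionsTwist hgL hL' hFL)
      (X_pow_dvd_pencil_of_mem_sectionsTwist hgM hM' hFM)

end SpaceCurve

end

theorem mainTheorem4 {k : Type*} [Field k] [IsAlgClosed k] (d m : ℕ) (hm : 1 ≤ m)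
    (hmd : m ≤ d - 1) (C D : (SpaceCurve.P3 k).IdealSheafData)
    (L M : TopologicalSpace.Closeds (SpaceCurve.P3 k))
    (hC : SpaceCurve.IsCdlOn C L m (d - m)) (hD : SpaceCurve.IsCdlOn D M (d - m) m)
    (hLM : Disjoint L M) :
    SpaceCurve.IsCurve (C ⊓ D) ∧
      SpaceCurve.HasDegreeGenus (C ⊓ D) d (SpaceCurve.beorchiaBound d d) ∧
      ¬ SpaceCurve.LiesOnSurface (C ⊓ D) (d - 1) := by
  obtain ⟨a, b, hab, hL⟩ := hC.isLine
  obtain ⟨a', b', hab', hM⟩ := hD.isLine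
  have hcompl := SpaceCurve.isCompl_span_of_disjoint_zeroLocus hab hab' <| by
    refine Set.disjoint_left.mpr fun x hxL hxM => ?_
    have hxL' : x ∈ (L : Set (SpaceCurve.P3 k)) := hL ▸ hxL
    have hxM' : x ∈ (M : Set (SpaceCurve.P3 k)) := hM ▸ hxM
    exact show x ∈ (⊥ : TopologicalSpace.Closeds (SpaceCurve.P3 k)) from hLM.eq_bot ▸ ⟨hxL', hxM'⟩
  obtain ⟨q, rfl⟩ : ∃ q, d = m + q := Nat.exists_eq_add_of_le (by omega)
  have hq : 1 ≤ q := by omega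
  rw [Nat.add_sub_cancel_left] at hC hD
  refine ⟨hC.isCurve.inf hD.isCurve (by rwa [hC.support_eq, hD.support_eq]), ?_, ?_⟩
  · have hsup := SpaceCurve.eventually_sectionsTwist_sup_eq_top (C := C) (D := D)
      (by rw [hC.support_eq, hL]) (by rw [hD.support_eq, hM]) hcompl.sup_eq_top
    filter_upwards [hsup, hC.degree_genus, hD.degree_genus] with n hn hCn hDn
    rw [SpaceCurve.hilbertFunction_inf_of_sup_eq_top hn, Nat.cast_add, hCn, hDn,
      SpaceCurve.beorchiaBound_add m q hm hq]
    push_cast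
    ring
  · rintro ⟨F, hF0, hF⟩
    have hCs := hC.sections_eq
    have hDs := hD.sections_eq
    rw [add_comm q m] at hCs
    rw [SpaceCurve.sectionsTwist_inf, hCs, hDs,
      SpaceCurve.sectionsTwist_vanishingIdeal_pow_inf_eq_bot hL hM hab hab' hcompl (by omega)] at hF
    exact hF0 ((Submodule.mem_bot k).mp hF)
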